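/- **Setting.** For a finite set $\mathcal X$, a state is a probability mass function on $\mathcal X$. A test is a function $T:\mathcal X\to[0,1]$, where $T(x)$ is the probability of accepting the null hypothesis on observing $x$. For a state $\varrho$ on $\mathcal X$ and $n\in\mathbb N$, $\varrho^{\otimes n}$ is the product state on $\mathcal X^n$. For a state $\varrho$ and a non-empty set $S$ of states on $\mathcal X$, and $r\in\mathbb R$, the strong converse exponent of testing $H_0:\varrho^{\otimes n}$ against the composite i.i.d. alternative $H_1:\{\sigma^{\otimes n}:\sigma\in S\}$ is $$\mathrm{sc}_r(\varrho\|S):=\inf\Big\{\limsup_{n\to\infty}-\tfrac1n\log\big(1-\alpha_n(T_n)\big)\ :\ \liminf_{n\to\infty}-\tfrac1n\log\beta_n(T_n)\ge r\Big\},$$ where the infimum is over all sequences of tests $T_n:\mathcal X^n\to[0,1]$, $\log$ is the natural logarithm with $\log 0:=-\infty$, and $$\alpha_n(T_n)=\sum_{x\in\mathcal X^n}\varrho^{\otimes n}(x)(1-T_n(x)),\qquad \beta_n(T_n)=\sup_{\sigma\in S}\sum_{x\in\mathcal X^n}\sigma^{\otimes n}(x)T_n(x).$$ Write $\mathrm{sc}_r(\varrho\|\sigma)$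 for $\mathrm{sc}_r(\varrho\|\{\sigma\})$, and $D$ for the relative entropy (Kullback–Leibler divergence). **Proposition.** Let $\varrho,\sigma_1,\sigma_2$ be the states on $\{h,t\}$ with $\varrho(h)=\frac12$, $\sigma_1(h)=\frac14$, $\sigma_2(h)=\frac34$, and let $k\ge 1$ be an integer. Then $$D(\varrho^{\otimes k}\|\sigma_1^{\otimes k})=D(\varrho^{\otimes k}\|\sigma_2^{\otimes k})=k\log\frac{2}{\sqrt3}.$$ For every real $r>k\log\frac{2}{\sqrt3}$ the exponents $\mathrm{sc}_r(\varrho^{\otimes k}\|\{\sigma_1^{\otimes k},\sigma_2^{\otimes k}\})$, $\mathrm{sc}_r(\varrho^{\otimes k}\|\sigma_1^{\otimes k})$, $\mathrm{sc}_r(\varrho^{\otimes k}\|\sigma_2^{\otimes k})$ lie in $[0,\infty)$, and $$\mathrm{sc}_r\big(\varrho^{\otimes k}\|\{\sigma_1^{\otimes k},\sigma_2^{\otimes k}\}\big)-\max_{j\in\{1,2\}}\mathrm{sc}_r\big(\varrho^{\otimes k}\|\sigma_j^{\otimes k}\big)>0;$$ in particular, $\mathrm{sc}_r(\varrho^{\otimes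 k}\|\{\sigma_1^{\otimes k},\sigma_2^{\otimes k}\})\ne\max_{j}\mathrm{sc}_r(\varrho^{\otimes k}\|\sigma_j^{\otimes k})$. For every real $r\ge k\log 4$, $$\mathrm{sc}_r\big(\varrho^{\otimes k}\|\{\sigma_1^{\otimes k},\sigma_2^{\otimes k}\}\big)-\max_{j\in\{1,2\}}\mathrm{sc}_r\big(\varrho^{\otimes k}\|\sigma_j^{\otimes k}\big)\ge k\log\sqrt3.$$ -/

import Mathlib

open scoped ENNReal

noncomputable section

namespace ClassicalDiscrimination

/-- The product state `ρ^{⊗n}` on `Xⁿ`: the law of `n` independent samples from `ρ`. -/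
def tensorPower {X : Type*} [Fintype X] (ρ : PMF X) (n : ℕ) : PMF (Fin n → X) :=
  PMF.ofFintype (fun x => ∏ i, ρ (x i)) (by
    rw [← Fintype.prod_sum (fun (_ : Fin n) (a : X) => ρ a)]
    have h : ∑ a, ρ a = 1 := by rw [← tsum_fintype (L := .unconditional X)]; exact ρ.tsum_coe
    simp [h])

/-- A (randomized) test on `X`: a `[0,1]`-valued function, `T x` being the probability of
accepting the null hypothesis on observing `x`. -/
def IsTest {X : Type*} (T : X → ℝ≥0∞) : Prop := ∀ x, T x ≤ 1

/-- Type I error probability: the worst-case probability of rejecting a true null hypothesis. -/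
def typeIError {X : Type*} [Fintype X] (R : Set (PMF X)) (T : X → ℝ≥0∞) : ℝ≥0∞ :=
  ⨆ ρ ∈ R, ∑ x, ρ x * (1 - T x)

/-- Type II error probability: the worst-case probability of accepting a false null hypothesis. -/
def typeIIError {X : Type*} [Fintype X] (S : Set (PMF X)) (T : X → ℝ≥0∞) : ℝ≥0∞ :=
  ⨆ σ ∈ S, ∑ x, σ x * T x

/-- The strong converse exponent `sc_r(H₀‖H₁)` of the problem with null hypothesis `(R n)ₙ` and
alternative hypothesis `(S n)ₙ`: the infimum of `limsup -(1/n) log (1 - αₙ(H₀|Tₙ))` over all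
sequences of tests with `liminf -(1/n) log βₙ(H₁|Tₙ) ≥ r`. Here `log 0 = -∞`. -/
def strongConverseExponent {X : ℕ → Type*} [∀ n, Fintype (X n)]
    (r : ℝ) (R S : ∀ n, Set (PMF (X n))) : EReal :=
  sInf {s : EReal | ∃ T : ∀ n, X n → ℝ≥0∞, (∀ n, IsTest (T n)) ∧
    (r : EReal) ≤ Filter.liminf
      (fun n : ℕ => -(ENNReal.log (typeIIError (S n) (T n)) / (n : EReal))) Filter.atTop ∧
    s = Filter.limsup
      (fun n : ℕ => -(ENNReal.log (1 - typeIError (R n) (T n)) / (n : EReal))) Filter.atTop}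

/-- The composite i.i.d. hypothesis `({σ^{⊗n} : σ ∈ S})ₙ`. -/
def iid {X : Type*} [Fintype X] (S : Set (PMF X)) (n : ℕ) : Set (PMF (Fin n → X)) :=
  (fun σ => tensorPower σ n) '' S

/-- `sc_r(ρ‖S)` for a simple i.i.d. null hypothesis and a composite i.i.d. alternative. -/
def sc {X : Type*} [Fintype X] (r : ℝ) (ρ : PMF X) (S : Set (PMF X)) : EReal :=
  strongConverseExponent r (iid {ρ}) (iid S)

end ClassicalDiscrimination

end

namespace ClassicalDiscrimination

open scoped NNReal
open Filter Topology

/-! ### Exponential rates in `EReal` as bounds on probabilities -/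

section EReal

/-! The null state is uniform with weight c, and the pointwise geometric mean of the two
alternatives is a constant d; both facts survive tensor powers. Write D = log (c/d), the common
relative entropy.

Against the pair, AM-GM gives q₁ + q₂ ≥ 2d pointwise, so over n samples the success probability of
any test is at most exp(nD) times its type II error. Hence the pair has exponent at least r - D
(`le_sc_pair`).

Against q₁ alone, a test can exploit a symbol x₀ that is rare under q₁: demand x₀ on a fraction l of
the positions and run a likelihood comparison on the rest (`sc_singleton_le`). For the coin, this
spends l k log 2 of success exponent and raises the type II exponent from D by l (k log 4 - D).
Since D < k log 2, the price is below r - D. The rare symbol is all heads for σ₁ and all tails for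
σ₂, so no such gain is available against both. -/

theorem coe_le_neg_log_div_iff {n : ℕ} (hn : 0 < n) (s : ℝ) (b : ℝ≥0∞) :
    (s : EReal) ≤ -(ENNReal.log b / (n : EReal)) ↔ b ≤ ENNReal.ofReal (Real.exp (-(n * s))) := by
  have hn' : (0 : EReal) < (n : EReal) := by exact_mod_cast hn
  have hnt : (n : EReal) ≠ ⊤ := EReal.natCast_ne_top n
  rw [EReal.le_neg, EReal.div_le_iff_le_mul hn' hnt, ← ENNReal.log_le_log_iff (x := b),
    ENNReal.log_ofReal, if_neg (not_le.mpr (Real.exp_pos _)), Real.log_exp]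
  have : (n : EReal) * -(s : EReal) = ((-(n * s) : ℝ) : EReal) := by
    rw [← mul_neg]; norm_cast
  rw [this]

theorem neg_log_div_le_coe_iff {n : ℕ} (hn : 0 < n) (s : ℝ) (b : ℝ≥0∞) :
    -(ENNReal.log b / (n : EReal)) ≤ (s : EReal) ↔ ENNReal.ofReal (Real.exp (-(n * s))) ≤ b := by
  have hn' : (0 : EReal) < (n : EReal) := by exact_mod_cast hn
  have hnt : (n : EReal) ≠ ⊤ := EReal.natCast_ne_top n
  rw [EReal.neg_le, EReal.le_div_iff_mul_le hn' hnt, ← ENNReal.log_le_log_iff (y := b),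
    ENNReal.log_ofReal, if_neg (not_le.mpr (Real.exp_pos _)), Real.log_exp]
  have : -(s : EReal) * (n : EReal) = ((-(n * s) : ℝ) : EReal) := by
    rw [mul_comm, ← mul_neg]; norm_cast
  rw [this]

end EReal

/-! ### General bounds on strong converse exponents -/

section General

variable {X : Type*} [Fintype X]

theorem sum_pmf (p : PMF X) : ∑ x, p x = 1 := by
  rw [← tsum_fintype (L := .unconditional X)]; exact p.tsum_coe

theorem tensorPower_apply (p : PMF X) (n : ℕ) (x : Fin n → X) :
    tensorPower p n x = ∏ i, p (x i) := rfl

theorem iid_singleton (p : PMF X) (n : ℕ) : iid {p} n = {tensorPower p n} := by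
  simp [iid]

theorem iid_pair (p q : PMF X) (n : ℕ) :
    iid {p, q} n = {tensorPower p n, tensorPower q n} := by
  simp [iid, Set.image_pair]

theorem one_sub_typeIError_singleton (p : PMF X) {T : X → ℝ≥0∞} (hT : IsTest T) :
    1 - typeIError {p} T = ∑ x, p x * T x := by
  have h : ∑ x, p x * T x + ∑ x, p x * (1 - T x) = 1 := by
    rw [← Finset.sum_add_distrib]
    refine (Finset.sum_congr rfl fun x _ => ?_).trans (sum_pmf p)
    rw [← mul_add, add_tsub_cancel_of_le (hT x), mul_one]
  have hle : ∑ x, p x * (1 - T x) ≤ 1 := le_add_self.trans h.le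
  simp only [typeIError, Set.mem_singleton_iff, iSup_iSup_eq_left]
  exact ENNReal.sub_eq_of_eq_add (ne_top_of_le_ne_top ENNReal.one_ne_top hle) h.symm

theorem sum_le_typeIIError {S : Set (PMF X)} {q : PMF X} (hq : q ∈ S) (T : X → ℝ≥0∞) :
    ∑ x, q x * T x ≤ typeIIError S T :=
  le_iSup₂ (f := fun (σ : PMF X) (_ : σ ∈ S) => ∑ x, σ x * T x) q hq

theorem sc_nonneg (r : ℝ) (p : PMF X) (S : Set (PMF X)) : 0 ≤ sc r p S := by
  refine le_sInf ?_
  rintro s ⟨T, -, -, rfl⟩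
  refine le_trans ?_ liminf_le_limsup
  refine le_liminf_of_le ?_ ?_
  · isBoundedDefault
  filter_upwards [eventually_gt_atTop 0] with n hn
  have := (coe_le_neg_log_div_iff hn 0 (1 - typeIError (iid {p} n) (T n))).mpr (by simp)
  simpa using this

/-- An achievability bound: tests with exponentially small type II error and success probability
of exponential order `exp (-n s)` bound the strong converse exponent by `s`. -/
theorem sc_le_of_tests {r s C : ℝ} {p : PMF X} {S : Set (PMF X)}
    (T : ∀ n : ℕ, (Fin n → X) → ℝ≥0∞) (hT : ∀ n, IsTest (T n))
    (hII : ∀ n : ℕ, ∀ q ∈ S,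
      ∑ x, tensorPower q n x * T n x ≤ ENNReal.ofReal (Real.exp (-(n * r))))
    (hI : ∀ n : ℕ, ENNReal.ofReal (Real.exp (-(n * s + C))) ≤ ∑ x, tensorPower p n x * T n x) :
    sc r p S ≤ s := by
  refine le_trans (sInf_le ⟨T, hT, ?_, rfl⟩) ?_
  · refine le_liminf_of_le ?_ ?_
    · isBoundedDefault
    filter_upwards [eventually_gt_atTop 0] with n hn
    rw [coe_le_neg_log_div_iff hn]
    refine iSup₂_le ?_
    rintro _ ⟨q, hq, rfl⟩
    exact hII n q hq
  · rw [← EReal.le_of_forall_lt_iff_le]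
    intro z hz
    have hz' : s < z := by exact_mod_cast hz
    refine limsup_le_of_le ?_ ?_
    · isBoundedDefault
    -- From this n on, n s + C ≤ n z, so the constant C does not affect the exponent.
    filter_upwards [eventually_gt_atTop 0, eventually_ge_atTop ⌈C / (z - s)⌉₊] with n hn hnC
    rw [neg_log_div_le_coe_iff hn, iid_singleton, one_sub_typeIError_singleton _ (hT n)]
    refine le_trans (ENNReal.ofReal_le_ofReal (Real.exp_le_exp.mpr ?_)) (hI n)
    have h1 : C / (z - s) ≤ n := (Nat.le_ceil _).trans (by exact_mod_cast hnC)
    rw [div_le_iff₀ (by linarith)] at h1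
    linarith

/-- A converse bound: if the success probability of every test is at most `exp (n L)` times its
type II error, then the strong converse exponent is at least `r - L`. -/
theorem le_sc_of_forall_tests {r L : ℝ} {p : PMF X} {S : Set (PMF X)}
    (h : ∀ (n : ℕ) (T : (Fin n → X) → ℝ≥0∞), ∑ x, tensorPower p n x * T x ≤
      ENNReal.ofReal (Real.exp (n * L)) * typeIIError (iid S n) T) :
    ((r - L : ℝ) : EReal) ≤ sc r p S := by
  refine le_sInf ?_
  rintro s ⟨T, hT, hr, rfl⟩
  refine le_trans ?_ liminf_le_limsup
  rw [← EReal.ge_of_forall_gt_iff_ge]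
  intro z hz
  have hz' : ((z + L : ℝ) : EReal) < liminf
      (fun n : ℕ => -(ENNReal.log (typeIIError (iid S n) (T n)) / (n : EReal))) atTop := by
    refine lt_of_lt_of_le ?_ hr
    have : z < r - L := by exact_mod_cast hz
    exact_mod_cast (by linarith : z + L < r)
  refine le_liminf_of_le ?_ ?_
  · isBoundedDefault
  filter_upwards [eventually_gt_atTop 0, eventually_lt_of_lt_liminf hz'] with n hn hlt
  have h1 := (coe_le_neg_log_div_iff hn _ _).mp hlt.le
  rw [coe_le_neg_log_div_iff hn, iid_singleton, one_sub_typeIError_singleton _ (hT n)]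
  calc _ ≤ ENNReal.ofReal (Real.exp (n * L)) * ENNReal.ofReal (Real.exp (-(n * (z + L)))) :=
        (h n (T n)).trans (by gcongr)
    _ = _ := by
        rw [← ENNReal.ofReal_mul (Real.exp_pos _).le, ← Real.exp_add]
        congr 2; ring

/-- The test that ignores the data and accepts with probability exp(-n r) suffices. This gives
finiteness of all exponents. -/
theorem sc_le_self {r : ℝ} (hr : 0 ≤ r) (p : PMF X) (S : Set (PMF X)) : sc r p S ≤ r := by
  have hsum (q : PMF X) (n : ℕ) : ∑ x, tensorPower q n x * ENNReal.ofReal (Real.exp (-(n * r)))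
      = ENNReal.ofReal (Real.exp (-(n * r))) := by
    rw [← Finset.sum_mul, sum_pmf, one_mul]
  refine sc_le_of_tests (C := 0) (fun n _ => ENNReal.ofReal (Real.exp (-(n * r)))) ?_ ?_ ?_
  · intro n x
    simp only [ENNReal.ofReal_le_one, Real.exp_le_one_iff]
    have : 0 ≤ n * r := by positivity
    linarith
  · intro n q _
    exact (hsum q n).le
  · intro n
    rw [hsum, add_zero]

end General

/-- `p` is the uniform state with weights `c`, the states `q₁` and `q₂` are exchanged by the
involution `f`, and their geometric mean is the constant `d`. -/
structure IsMirrored {X : Type*} (p q₁ q₂ : PMF X) (c d : ℝ≥0) (f : X → X) : Prop where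
  uniform : ∀ x, p x = c
  mul : ∀ x, q₁ x * q₂ x = d ^ 2
  invol : Function.Involutive f
  map : ∀ x, q₁ (f x) = q₂ x

/-! ### Mirrored pairs: converse bound and relative entropy -/

namespace IsMirrored

variable {X : Type*} {p q₁ q₂ : PMF X} {c d : ℝ≥0} {f : X → X}

theorem map' (h : IsMirrored p q₁ q₂ c d f) (x : X) : q₂ (f x) = q₁ x := by
  rw [← h.map, h.invol]

theorem swap (h : IsMirrored p q₁ q₂ c d f) : IsMirrored p q₂ q₁ c d f :=
  ⟨h.uniform, fun x => by rw [mul_comm, h.mul], h.invol, h.map'⟩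

/-- AM-GM, with d the geometric mean. -/
theorem two_mul_le (h : IsMirrored p q₁ q₂ c d f) (x : X) : 2 * (d : ℝ≥0∞) ≤ q₁ x + q₂ x := by
  have hm := h.mul x
  lift q₁ x to ℝ≥0 using q₁.apply_ne_top x with a
  lift q₂ x to ℝ≥0 using q₂.apply_ne_top x with b
  norm_cast at hm ⊢
  have hm' : (a : ℝ) * b = d ^ 2 := by exact_mod_cast congrArg NNReal.toReal hm
  rw [← NNReal.coe_le_coe]
  push_cast
  refine abs_le_of_sq_le_sq' ?_ (by positivity) |>.2
  nlinarith [sq_nonneg ((a : ℝ) - b)]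

variable [Fintype X]

theorem tensorPower (h : IsMirrored p q₁ q₂ c d f) (n : ℕ) :
    IsMirrored (tensorPower p n) (tensorPower q₁ n) (tensorPower q₂ n) (c ^ n) (d ^ n)
      (fun x i => f (x i)) where
  uniform x := by simp [tensorPower_apply, h.uniform]
  mul x := by
    simp only [tensorPower_apply]
    rw [← Finset.prod_mul_distrib]
    simp [h.mul, ← pow_mul, mul_comm]
  invol x := by funext i; exact h.invol _
  map x := by simp [tensorPower_apply, h.map]

theorem card_mul (h : IsMirrored p q₁ q₂ c d f) : (Fintype.card X : ℝ≥0∞) * c = 1 := by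
  rw [← sum_pmf p]; simp [h.uniform]

theorem pos (h : IsMirrored p q₁ q₂ c d f) : 0 < c := by
  have := h.card_mul
  rcases eq_zero_or_pos c with hc | hc
  · simp [hc] at this
  · exact hc

theorem sum_le_typeIIError_pair (h : IsMirrored p q₁ q₂ c d f) (hd : d ≠ 0) (T : X → ℝ≥0∞) :
    ∑ x, p x * T x ≤ ((c / d : ℝ≥0) : ℝ≥0∞) * typeIIError {q₁, q₂} T := by
  have h1 := sum_le_typeIIError (S := {q₁, q₂}) (q := q₁) (by simp) T
  have h2 := sum_le_typeIIError (S := {q₁, q₂}) (q := q₂) (by simp) T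
  set b := typeIIError {q₁, q₂} T
  have h3 : 2 * (d * ∑ x, T x) ≤ 2 * b := by
    calc 2 * (d * ∑ x, T x) = ∑ x, 2 * d * T x := by rw [← mul_assoc, Finset.mul_sum]
      _ ≤ ∑ x, (q₁ x + q₂ x) * T x := by gcongr with x; exact h.two_mul_le x
      _ = ∑ x, q₁ x * T x + ∑ x, q₂ x * T x := by
        rw [← Finset.sum_add_distrib]; simp only [add_mul]
      _ ≤ 2 * b := by rw [two_mul]; gcongr
  have h4 : d * ∑ x, T x ≤ b :=
    (ENNReal.mul_le_mul_iff_right (by simp) (by simp)).mp h3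
  calc ∑ x, p x * T x = c * ∑ x, T x := by simp only [h.uniform, Finset.mul_sum]
    _ = ((c / d : ℝ≥0) : ℝ≥0∞) * (d * ∑ x, T x) := by
      rw [← mul_assoc, ← ENNReal.coe_mul, div_mul_cancel₀ _ hd]
    _ ≤ _ := by gcongr

theorem le_sc_pair (h : IsMirrored p q₁ q₂ c d f) (hd : d ≠ 0) (r : ℝ) :
    ((r - Real.log (c / d) : ℝ) : EReal) ≤ sc r p {q₁, q₂} := by
  refine le_sc_of_forall_tests fun n T => ?_
  have := (h.tensorPower n).sum_le_typeIIError_pair (pow_ne_zero n hd) T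
  rw [iid_pair]
  convert this using 2
  have hcd : (0 : ℝ) < c / d := div_pos h.pos (by exact_mod_cast pos_iff_ne_zero.mpr hd)
  rw [Real.exp_nat_mul, Real.exp_log hcd, ← div_pow, ← NNReal.coe_div, ← NNReal.coe_pow,
    ENNReal.ofReal_coe_nnreal]

/-- The involution makes the sums of log q₁ and log q₂ equal, while log q₁ + log q₂ = 2 log d
pointwise; so log q₁ has uniform average log d. -/
theorem klDiv_eq (h : IsMirrored p q₁ q₂ c d f) (hd : d ≠ 0) [MeasurableSpace X]
    [MeasurableSingletonClass X] :
    InformationTheory.klDiv p.toMeasure q₁.toMeasure = ENNReal.ofReal (Real.log (c / d)) := by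
  have hq (x : X) : q₁ x ≠ 0 := by
    intro h0
    have := h.mul x
    rw [h0, zero_mul] at this
    exact pow_ne_zero 2 (ENNReal.coe_ne_zero.mpr hd) this.symm
  have hq' (x : X) : q₂ x ≠ 0 := by rw [← h.map]; exact hq _
  have hac : p.toMeasure.AbsolutelyContinuous q₁.toMeasure := by
    intro s hs
    rw [PMF.toMeasure_apply_eq_zero_iff _ s.toFinite.measurableSet] at hs ⊢
    refine hs.mono_left ?_
    intro x _
    exact (PMF.mem_support_iff _ _).mpr (hq x)
  have hrn (x : X) : p.toMeasure.rnDeriv q₁.toMeasure x = c / q₁ x := by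
    have := MeasureTheory.Measure.setLIntegral_rnDeriv hac {x}
    rw [MeasureTheory.lintegral_singleton, PMF.toMeasure_apply_singleton _ _ (by simp),
      PMF.toMeasure_apply_singleton _ _ (by simp), h.uniform] at this
    rw [← this, ENNReal.mul_div_cancel_right (hq x) (q₁.apply_ne_top x)]
  have hsum : ∑ x, Real.log (q₁ x).toReal = Fintype.card X * Real.log d := by
    have hflip : ∑ x, Real.log (q₁ x).toReal = ∑ x, Real.log (q₂ x).toReal := by
      rw [← Equiv.sum_comp h.invol.toPerm]
      simp [h.map]
    have hadd : ∑ x, Real.log (q₁ x).toReal + ∑ x, Real.log (q₂ x).toReal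
        = Fintype.card X * (2 * Real.log d) := by
      rw [← Finset.sum_add_distrib, ← nsmul_eq_mul]
      refine Finset.sum_eq_card_nsmul fun x _ => ?_
      rw [← Real.log_mul (ENNReal.toReal_ne_zero.mpr ⟨hq x, q₁.apply_ne_top x⟩)
        (ENNReal.toReal_ne_zero.mpr ⟨hq' x, q₂.apply_ne_top x⟩), ← ENNReal.toReal_mul, h.mul]
      simp
    linarith
  have hcard : (Fintype.card X : ℝ) * c = 1 := by
    have := congrArg ENNReal.toReal h.card_mul
    simpa using this
  rw [← ENNReal.ofReal_toReal (InformationTheory.klDiv_ne_top hac .of_finite),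
    InformationTheory.toReal_klDiv_of_measure_eq hac (by simp),
    MeasureTheory.integral_fintype .of_finite]
  congr 1
  have hterm (x : X) : p.toMeasure.real {x} • MeasureTheory.llr p.toMeasure q₁.toMeasure x
      = c * (Real.log c - Real.log (q₁ x).toReal) := by
    rw [MeasureTheory.llr, hrn, MeasureTheory.measureReal_def,
      PMF.toMeasure_apply_singleton _ _ (by simp), h.uniform, ENNReal.toReal_div,
      Real.log_div (by simpa using h.pos.ne')
        (ENNReal.toReal_ne_zero.mpr ⟨hq x, q₁.apply_ne_top x⟩)]
    simp
  simp only [hterm]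
  rw [← Finset.mul_sum, Finset.sum_sub_distrib, hsum,
    Real.log_div (by simpa using h.pos.ne') (by simpa using hd)]
  simp only [Finset.sum_const, Finset.card_univ, nsmul_eq_mul]
  linear_combination (Real.log c - Real.log d) * hcard

end IsMirrored

/-! ### The prefix test -/

section PrefixTest

theorem prod_ite_lt {M : Type*} [CommMonoid M] {n m : ℕ} (hm : m ≤ n) (a b : M) :
    ∏ i : Fin n, (if i.val < m then a else b) = a ^ m * b ^ (n - m) := by
  have h := Finset.card_filter_add_card_filter_not (s := (Finset.univ : Finset (Fin n)))
    (fun i => i.val < m)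
  rw [Fin.card_filter_val_lt, min_eq_right hm, Finset.card_univ, Fintype.card_fin] at h
  rw [Finset.prod_ite, Finset.prod_const, Finset.prod_const, Fin.card_filter_val_lt,
    min_eq_right hm, show Finset.card _ = n - m by omega]

variable {X : Type*}

open Classical in
/-- The indicator function of the sequences whose first `m` symbols are all `x₀`. -/
noncomputable def prefixIndicator (n m : ℕ) (x₀ : X) (x : Fin n → X) : ℝ≥0∞ :=
  ∏ i, if i.val < m then (if x i = x₀ then 1 else 0) else 1

/-- The likelihood under `q` of all but the first `m` symbols. -/
noncomputable def suffixLikelihood (n m : ℕ) (q : PMF X) (x : Fin n → X) : ℝ≥0∞ :=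
  ∏ i, if i.val < m then 1 else q (x i)

open Classical in
/-- The test accepting if the first `m` symbols are all `x₀` and the remaining symbols are at
least as likely under `q₂` as under `q₁`. -/
noncomputable def prefixTest (n m : ℕ) (x₀ : X) (q₁ q₂ : PMF X) (x : Fin n → X) : ℝ≥0∞ :=
  if suffixLikelihood n m q₁ x ≤ suffixLikelihood n m q₂ x then prefixIndicator n m x₀ x else 0

theorem prefixTest_le_one (n m : ℕ) (x₀ : X) (q₁ q₂ : PMF X) (x : Fin n → X) :
    prefixTest n m x₀ q₁ q₂ x ≤ 1 := by
  unfold prefixTest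
  split_ifs
  · refine Finset.prod_le_one' fun i _ => ?_
    split_ifs <;> simp
  · simp

variable [Fintype X]

theorem sum_prefixIndicator {n m : ℕ} (hm : m ≤ n) (x₀ : X) :
    ∑ x, prefixIndicator n m x₀ x = (Fintype.card X : ℝ≥0∞) ^ (n - m) := by
  classical
  unfold prefixIndicator
  rw [← Fintype.prod_sum (fun (i : Fin n) (a : X) =>
    if i.val < m then (if a = x₀ then (1 : ℝ≥0∞) else 0) else 1)]
  rw [← one_mul (_ ^ (n - m)), ← one_pow m, ← prod_ite_lt hm]
  refine Finset.prod_congr rfl fun i _ => ?_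
  split_ifs <;> simp

theorem tensorPower_mul_prefixIndicator {n m : ℕ} (hm : m ≤ n) (x₀ : X) (q : PMF X)
    (x : Fin n → X) : tensorPower q n x * prefixIndicator n m x₀ x =
      q x₀ ^ m * suffixLikelihood n m q x * prefixIndicator n m x₀ x := by
  rw [← mul_one (q x₀ ^ m), ← one_pow (n - m), ← prod_ite_lt hm, tensorPower_apply]
  unfold suffixLikelihood prefixIndicator
  simp only [← Finset.prod_mul_distrib]
  refine Finset.prod_congr rfl fun i _ => ?_
  split_ifs with h1 h2
  · simp [h2]
  · simp
  · simp

end PrefixTest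

/-! ### Error analysis of the prefix test -/

namespace IsMirrored

variable {X : Type*} {p q₁ q₂ : PMF X} {c d : ℝ≥0} {f : X → X} {n m : ℕ}

/-- The two suffix likelihoods multiply to the square of d ^ (n - m), so the smaller is at most d ^
(n - m). -/
theorem suffixLikelihood_le (h : IsMirrored p q₁ q₂ c d f) (hm : m ≤ n) {x : Fin n → X}
    (hx : suffixLikelihood n m q₁ x ≤ suffixLikelihood n m q₂ x) :
    suffixLikelihood n m q₁ x ≤ d ^ (n - m) := by
  have hmul : suffixLikelihood n m q₁ x * suffixLikelihood n m q₂ x = (d ^ (n - m)) ^ 2 := by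
    rw [← pow_mul, mul_comm _ 2, pow_mul, ← one_mul (_ ^ (n - m)), ← one_pow m, ← prod_ite_lt hm]
    unfold suffixLikelihood
    rw [← Finset.prod_mul_distrib]
    refine Finset.prod_congr rfl fun i _ => ?_
    split_ifs
    · simp
    · exact h.mul _
  refine (ENNReal.pow_le_pow_left_iff two_ne_zero).mp ?_
  rw [← hmul, sq]
  gcongr

variable [Fintype X]

/-- Applying `f` to the suffix only exchanges the two likelihoods, so the tests with q₁ and q₂
interchanged have equal mass. Together they cover every sequence with the right prefix, with ties
counted twice. -/
theorem sum_prefixIndicator_le (h : IsMirrored p q₁ q₂ c d f) (x₀ : X) :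
    ∑ x, prefixIndicator n m x₀ x ≤ 2 * ∑ x, prefixTest n m x₀ q₁ q₂ x := by
  classical
  let F : (Fin n → X) → Fin n → X := fun x i => if i.val < m then x i else f (x i)
  have hF : Function.Involutive F := by
    intro x
    funext i
    by_cases hi : i.val < m <;> simp [F, hi, h.invol _]
  have hI (x) : prefixIndicator n m x₀ (F x) = prefixIndicator n m x₀ x := by
    refine Finset.prod_congr rfl fun i _ => ?_
    by_cases hi : i.val < m <;> simp [F, hi]
  have h1 (x) : suffixLikelihood n m q₁ (F x) = suffixLikelihood n m q₂ x := by
    refine Finset.prod_congr rfl fun i _ => ?_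
    by_cases hi : i.val < m <;> simp [F, hi, h.map]
  have h2 (x) : suffixLikelihood n m q₂ (F x) = suffixLikelihood n m q₁ x := by
    rw [← h1, hF]
  have hswap : ∑ x, prefixTest n m x₀ q₂ q₁ x = ∑ x, prefixTest n m x₀ q₁ q₂ x := by
    rw [← Equiv.sum_comp hF.toPerm]
    simp [prefixTest, hI, h1, h2]
  rw [two_mul]
  nth_rewrite 1 [← hswap]
  rw [← Finset.sum_add_distrib]
  refine Finset.sum_le_sum fun x _ => ?_
  unfold prefixTest
  rcases le_total (suffixLikelihood n m q₁ x) (suffixLikelihood n m q₂ x) with hx | hx <;>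
    simp [hx]

theorem sum_tensorPower_mul_prefixTest_le (h : IsMirrored p q₁ q₂ c d f) (hm : m ≤ n) {x₀ : X}
    {e : ℝ≥0} (he : q₁ x₀ = e) :
    ∑ x, ClassicalDiscrimination.tensorPower q₁ n x * prefixTest n m x₀ q₁ q₂ x ≤
      ((e ^ m * (d / c) ^ (n - m) : ℝ≥0) : ℝ≥0∞) := by
  classical
  have hcard : (Fintype.card X : ℝ≥0∞) = (c⁻¹ : ℝ≥0) := by
    have := h.card_mul
    norm_cast at this ⊢
    exact eq_inv_of_mul_eq_one_left this
  calc ∑ x, ClassicalDiscrimination.tensorPower q₁ n x * prefixTest n m x₀ q₁ q₂ x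
      ≤ ∑ x, (e ^ m * d ^ (n - m) * prefixIndicator n m x₀ x : ℝ≥0∞) := by
        refine Finset.sum_le_sum fun x _ => ?_
        unfold prefixTest
        split_ifs with hx
        · rw [tensorPower_mul_prefixIndicator hm, he]
          gcongr
          exact h.suffixLikelihood_le hm hx
        · simp
    _ = _ := by
        rw [← Finset.mul_sum, sum_prefixIndicator hm, hcard, mul_assoc, ← mul_pow]
        push_cast
        rw [← ENNReal.coe_mul, div_eq_mul_inv]

theorem le_sum_tensorPower_mul_prefixTest (h : IsMirrored p q₁ q₂ c d f) (hm : m ≤ n) (x₀ : X) :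
    ((c ^ m / 2 : ℝ≥0) : ℝ≥0∞) ≤
      ∑ x, ClassicalDiscrimination.tensorPower p n x * prefixTest n m x₀ q₁ q₂ x := by
  have h1 := h.sum_prefixIndicator_le (n := n) (m := m) x₀
  rw [sum_prefixIndicator hm] at h1
  simp only [(h.tensorPower n).uniform, ← Finset.mul_sum]
  rw [ENNReal.coe_div two_ne_zero]
  refine ENNReal.div_le_of_le_mul ?_
  calc ((c ^ m : ℝ≥0) : ℝ≥0∞)
      = ((c ^ n : ℝ≥0) : ℝ≥0∞) * (Fintype.card X : ℝ≥0∞) ^ (n - m) := by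
        push_cast
        conv_rhs => rw [← Nat.sub_add_cancel hm, Nat.add_sub_cancel]
        rw [pow_add, mul_right_comm, ← mul_pow, mul_comm (c : ℝ≥0∞), h.card_mul, one_pow, one_mul]
    _ ≤ ((c ^ n : ℝ≥0) : ℝ≥0∞) * (2 * ∑ x, prefixTest n m x₀ q₁ q₂ x) := by gcongr
    _ = _ := by push_cast; ring

/-- Here l is the fraction of positions in the prefix, and t comes from damping the test by exp(-n
t), which adds t to both exponents. -/
theorem sc_singleton_le (h : IsMirrored p q₁ q₂ c d f) (hd : d ≠ 0) {x₀ : X} {e : ℝ≥0}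
    (he : q₁ x₀ = e) (he0 : e ≠ 0) (hed : e ≤ d / c) {l t : ℝ} (hl0 : 0 ≤ l) (hl1 : l ≤ 1)
    (ht : 0 ≤ t) :
    sc (l * -Real.log e + (1 - l) * Real.log (c / d) + t) p {q₁} ≤
      ((l * -Real.log c + t : ℝ) : EReal) := by
  have hc : (0 : ℝ) < c := h.pos
  have hd' : (0 : ℝ) < d := by exact_mod_cast pos_iff_ne_zero.mpr hd
  have he' : (0 : ℝ) < e := by exact_mod_cast pos_iff_ne_zero.mpr he0
  have hc1 : Real.log c ≤ 0 := by
    refine Real.log_nonpos hc.le ?_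
    have := p.coe_le_one x₀
    rw [h.uniform] at this
    exact_mod_cast this
  have hle : Real.log e ≤ -Real.log (c / d) := by
    rw [← Real.log_inv, inv_div]
    exact Real.log_le_log he' (by exact_mod_cast hed)
  have hm (n : ℕ) : ⌈l * n⌉₊ ≤ n :=
    Nat.ceil_le.mpr (mul_le_of_le_one_left n.cast_nonneg hl1)
  have hpow {a : ℝ} (ha : 0 < a) (j : ℕ) : a ^ j = Real.exp (j * Real.log a) := by
    rw [Real.exp_nat_mul, Real.exp_log ha]
  -- In C, log 2 pays for the factor 1/2 in the success probability and -log c for rounding l n up.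
  refine sc_le_of_tests (C := Real.log 2 - Real.log c) (fun n x =>
    ENNReal.ofReal (Real.exp (-(n * t))) * prefixTest n ⌈l * n⌉₊ x₀ q₁ q₂ x) ?_ ?_ ?_
  · intro n x
    refine mul_le_one' ?_ (prefixTest_le_one _ _ _ _ _ _)
    rw [ENNReal.ofReal_le_one, Real.exp_le_one_iff]
    have : 0 ≤ n * t := by positivity
    linarith
  · rintro n q rfl
    simp only [mul_left_comm _ (ENNReal.ofReal _), ← Finset.mul_sum]
    refine (mul_le_mul_right (h.sum_tensorPower_mul_prefixTest_le (hm n) he) _).trans ?_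
    rw [← ENNReal.ofReal_coe_nnreal, ← ENNReal.ofReal_mul (Real.exp_pos _).le]
    refine ENNReal.ofReal_le_ofReal ?_
    push_cast
    rw [hpow he', hpow (div_pos hd' hc), ← Real.exp_add, ← Real.exp_add, Real.exp_le_exp,
      Nat.cast_sub (hm n), ← inv_div (c : ℝ) d, Real.log_inv]
    -- As e ≤ d/c, rounding the prefix length up can only decrease the type II bound.
    nlinarith [mul_nonneg (sub_nonneg.mpr (Nat.le_ceil (l * n))) (sub_nonneg.mpr hle)]
  · intro n
    simp only [mul_left_comm _ (ENNReal.ofReal _), ← Finset.mul_sum]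
    refine le_trans ?_ (mul_le_mul_right (h.le_sum_tensorPower_mul_prefixTest (hm n) x₀) _)
    rw [← ENNReal.ofReal_coe_nnreal, ← ENNReal.ofReal_mul (Real.exp_pos _).le]
    refine ENNReal.ofReal_le_ofReal ?_
    push_cast
    rw [hpow hc, div_eq_mul_inv, ← Real.exp_log (show (0 : ℝ) < 2⁻¹ by norm_num), ← Real.exp_add,
      ← Real.exp_add, Real.exp_le_exp, Real.log_inv]
    have := (Nat.ceil_lt_add_one (show 0 ≤ l * n by positivity)).le
    nlinarith [mul_nonneg (sub_nonneg.mpr this) (neg_nonneg.mpr hc1)]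

end IsMirrored

/-! ### The coin example -/

section Coin

theorem isMirrored_coin {ρ σ₁ σ₂ : PMF Bool} (hρ : ρ true = 1 / 2) (hσ₁ : σ₁ true = 1 / 4)
    (hσ₂ : σ₂ true = 3 / 4) :
    IsMirrored ρ σ₁ σ₂ 2⁻¹ (NNReal.sqrt 3 / 4) not ∧ σ₁ true = (4⁻¹ : ℝ≥0) ∧
      σ₂ false = (4⁻¹ : ℝ≥0) := by
  have key (p : PMF Bool) (a b : ℝ≥0) (hab : a + b = 1) (hp : p true = a) : p false = b := by
    have h := sum_pmf p
    rw [Fintype.sum_bool, hp] at h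
    have : (a : ℝ≥0∞) + p false = a + b := by rw [h]; exact_mod_cast hab.symm
    exact (ENNReal.add_right_inj ENNReal.coe_ne_top).mp this
  have e1 : ρ true = (2⁻¹ : ℝ≥0) := by rw [hρ]; simp
  have e2 : σ₁ true = (4⁻¹ : ℝ≥0) := by rw [hσ₁]; simp
  have e3 : σ₂ true = (3 / 4 : ℝ≥0) := by rw [hσ₂, ENNReal.coe_div (by norm_num)]; simp
  have f1 : ρ false = (2⁻¹ : ℝ≥0) := key _ _ _ (by rw [← NNReal.coe_inj]; push_cast; norm_num) e1
  have f2 : σ₁ false = (3 / 4 : ℝ≥0) :=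
    key _ _ _ (by rw [← NNReal.coe_inj]; push_cast; norm_num) e2
  have f3 : σ₂ false = (4⁻¹ : ℝ≥0) :=
    key _ _ _ (by rw [← NNReal.coe_inj]; push_cast; norm_num) e3
  have hd : (4⁻¹ : ℝ≥0) * (3 / 4) = (NNReal.sqrt 3 / 4) ^ 2 := by
    rw [div_pow, NNReal.sq_sqrt, ← NNReal.coe_inj]; push_cast; norm_num
  refine ⟨⟨?_, ?_, Bool.not_not, ?_⟩, e2, f3⟩
  · rintro (_ | _) <;> assumption
  · rintro (_ | _)
    · rw [f2, f3, mul_comm]; exact_mod_cast hd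
    · rw [e2, e3]; exact_mod_cast hd
  · rintro (_ | _)
    · rw [Bool.not_false, e2, f3]
    · rw [Bool.not_true, f2, e3]

theorem log_coin_ratio (k : ℕ) :
    Real.log (((2⁻¹ ^ k : ℝ≥0) : ℝ) / (((NNReal.sqrt 3 / 4) ^ k : ℝ≥0) : ℝ))
      = k * Real.log (2 / √3) := by
  push_cast
  rw [← div_pow, Real.log_pow]
  congr 2
  have : √3 ≠ 0 := by positivity
  field_simp
  norm_num

variable {X : Type*} [Fintype X] {p q₁ q₂ : PMF X} {f : X → X} {k : ℕ}

theorem sc_singleton_le_of_coin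
    (h : IsMirrored p q₁ q₂ (2⁻¹ ^ k) ((NNReal.sqrt 3 / 4) ^ k) f) {x₀ : X}
    (he : q₁ x₀ = ((4⁻¹ ^ k : ℝ≥0) : ℝ≥0∞)) {l t r : ℝ} (hl0 : 0 ≤ l) (hl1 : l ≤ 1)
    (ht : 0 ≤ t)
    (hr : r = l * (k * Real.log 4) + (1 - l) * (k * Real.log (2 / √3)) + t) :
    sc r p {q₁} ≤ ((l * (k * Real.log 2) + t : ℝ) : EReal) := by
  have h1 : (1 : ℝ≥0) ≤ NNReal.sqrt 3 := by
    rw [NNReal.le_sqrt_iff_sq_le]; norm_num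
  have := h.sc_singleton_le (l := l) (t := t) (by positivity) he (by positivity) ?_ hl0 hl1 ht
  · rw [log_coin_ratio] at this
    have hlog (a : ℝ) : -Real.log (a⁻¹ ^ k) = k * Real.log a := by
      rw [Real.log_pow, Real.log_inv]; ring
    simp only [NNReal.coe_pow, NNReal.coe_inv, NNReal.coe_ofNat, hlog] at this
    rwa [hr]
  · rw [← div_pow]
    refine pow_le_pow_left₀ (by positivity) ?_ k
    rw [← NNReal.coe_le_coe] at h1 ⊢
    push_cast at h1 ⊢
    rw [div_inv_eq_mul]
    linarith

theorem log_two_div_sqrt_three_lt : Real.log (2 / √3) < Real.log 2 := by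
  refine Real.log_lt_log (by positivity) ?_
  rw [div_lt_iff₀ (by positivity)]
  have : 1 < √3 := by rw [Real.lt_sqrt] <;> norm_num
  linarith

theorem log_four : Real.log 4 = 2 * Real.log 2 := by
  rw [show (4 : ℝ) = 2 ^ 2 by norm_num, Real.log_pow]; norm_num

theorem log_two_div_sqrt_three_nonneg : 0 ≤ Real.log (2 / √3) := by
  refine Real.log_nonneg ?_
  rw [one_le_div (by positivity), Real.sqrt_le_left (by norm_num)]
  norm_num

/-- Up to r = k log 4 a suitable l suffices without damping; beyond it, l = 1 and damping covers the
excess. Both cases are strict because log (2/√3) < log 2. -/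
theorem sc_singleton_lt_of_coin (hk : 1 ≤ k)
    (h : IsMirrored p q₁ q₂ (2⁻¹ ^ k) ((NNReal.sqrt 3 / 4) ^ k) f) {x₀ : X}
    (he : q₁ x₀ = ((4⁻¹ ^ k : ℝ≥0) : ℝ≥0∞)) {r : ℝ} (hr : k * Real.log (2 / √3) < r) :
    sc r p {q₁} < ((r - k * Real.log (2 / √3) : ℝ) : EReal) := by
  have hk' : (0 : ℝ) < k := by exact_mod_cast hk
  have hlt := log_two_div_sqrt_three_lt
  have h0 := log_two_div_sqrt_three_nonneg
  have hlt' : k * Real.log (2 / √3) < k * Real.log 2 := by gcongr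
  have h4 := log_four
  rcases le_total (k * Real.log 4) r with h4r | h4r
  · refine (sc_singleton_le_of_coin h he (l := 1) (t := r - k * Real.log 4) zero_le_one le_rfl
      (by linarith) (by ring)).trans_lt ?_
    rw [EReal.coe_lt_coe_iff, h4]
    linarith
  · have hgap : 0 < k * Real.log 4 - k * Real.log (2 / √3) := by rw [h4]; nlinarith
    have hpos : 0 < (r - k * Real.log (2 / √3)) / (k * Real.log 4 - k * Real.log (2 / √3)) :=
      div_pos (by linarith) hgap
    have hmul : (r - k * Real.log (2 / √3)) / (k * Real.log 4 - k * Real.log (2 / √3)) *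
      (k * Real.log 4 - k * Real.log (2 / √3)) = r - k * Real.log (2 / √3) :=
      div_mul_cancel₀ _ hgap.ne'
    -- This l solves the rate equation with t = 0.
    set l := (r - k * Real.log (2 / √3)) / (k * Real.log 4 - k * Real.log (2 / √3)) with hl
    refine (sc_singleton_le_of_coin h he (l := l) (t := 0) hpos.le ?_ le_rfl (by linarith)).trans_lt
      ?_
    · rw [hl, div_le_one hgap]; linarith
    · rw [EReal.coe_lt_coe_iff, add_zero, ← hmul]
      refine mul_lt_mul_of_pos_left ?_ hpos
      rw [h4]; linarith

end Coin

end ClassicalDiscrimination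

open ClassicalDiscrimination in
theorem mainTheorem4
    (ρ σ₁ σ₂ : PMF Bool)
    (hρ : ρ true = 1 / 2) (hσ₁ : σ₁ true = 1 / 4) (hσ₂ : σ₂ true = 3 / 4)
    (k : ℕ) (hk : 1 ≤ k) :
    InformationTheory.klDiv (tensorPower ρ k).toMeasure (tensorPower σ₁ k).toMeasure
        = ENNReal.ofReal (k * Real.log (2 / √3)) ∧
    InformationTheory.klDiv (tensorPower ρ k).toMeasure (tensorPower σ₂ k).toMeasure
        = ENNReal.ofReal (k * Real.log (2 / √3)) ∧
    ∀ r : ℝ,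
      (k * Real.log (2 / √3) < r →
        sc r (tensorPower ρ k) {tensorPower σ₁ k, tensorPower σ₂ k} ∈ Set.Ico (0 : EReal) ⊤ ∧
        sc r (tensorPower ρ k) {tensorPower σ₁ k} ∈ Set.Ico (0 : EReal) ⊤ ∧
        sc r (tensorPower ρ k) {tensorPower σ₂ k} ∈ Set.Ico (0 : EReal) ⊤ ∧
        sc r (tensorPower ρ k) {tensorPower σ₁ k, tensorPower σ₂ k} ≠
          max (sc r (tensorPower ρ k) {tensorPower σ₁ k})
            (sc r (tensorPower ρ k) {tensorPower σ₂ k}) ∧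
        0 < sc r (tensorPower ρ k) {tensorPower σ₁ k, tensorPower σ₂ k} -
          max (sc r (tensorPower ρ k) {tensorPower σ₁ k})
            (sc r (tensorPower ρ k) {tensorPower σ₂ k})) ∧
      (k * Real.log 4 ≤ r →
        ((k * Real.log (√3) : ℝ) : EReal) ≤
          sc r (tensorPower ρ k) {tensorPower σ₁ k, tensorPower σ₂ k} -
          max (sc r (tensorPower ρ k) {tensorPower σ₁ k})
            (sc r (tensorPower ρ k) {tensorPower σ₂ k})) := by
  obtain ⟨hcoin, htrue, hfalse⟩ := isMirrored_coin hρ hσ₁ hσ₂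
  have h := hcoin.tensorPower k
  have he₁ : tensorPower σ₁ k (fun _ => true) = ((4⁻¹ ^ k : NNReal) : ℝ≥0∞) := by
    simp only [tensorPower_apply, htrue, Finset.prod_const, Finset.card_univ, Fintype.card_fin,
      ENNReal.coe_pow]
  have he₂ : tensorPower σ₂ k (fun _ => false) = ((4⁻¹ ^ k : NNReal) : ℝ≥0∞) := by
    simp only [tensorPower_apply, hfalse, Finset.prod_const, Finset.card_univ, Fintype.card_fin,
      ENNReal.coe_pow]
  have hd : (NNReal.sqrt 3 / 4) ^ k ≠ 0 := by positivity
  have hk' : (0 : ℝ) < k := by exact_mod_cast hk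
  have h0 : 0 ≤ k * Real.log (2 / √3) := mul_nonneg hk'.le log_two_div_sqrt_three_nonneg
  refine ⟨by rw [h.klDiv_eq hd, log_coin_ratio], by rw [h.swap.klDiv_eq hd, log_coin_ratio],
    fun r => ?_⟩
  have hlow := h.le_sc_pair hd r
  rw [log_coin_ratio] at hlow
  have hmem (hr : 0 ≤ r) (S : Set (PMF (Fin k → Bool))) :
      sc r (tensorPower ρ k) S ∈ Set.Ico (0 : EReal) ⊤ :=
    ⟨sc_nonneg _ _ _, (sc_le_self hr _ _).trans_lt (EReal.coe_lt_top r)⟩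
  refine ⟨fun hr => ?_, fun hr => ?_⟩
  · have hmax := max_lt (sc_singleton_lt_of_coin hk h he₁ hr)
      (sc_singleton_lt_of_coin hk h.swap he₂ hr)
    have hlt := hmax.trans_le hlow
    exact ⟨hmem (h0.trans hr.le) _, hmem (h0.trans hr.le) _, hmem (h0.trans hr.le) _, hlt.ne',
      EReal.sub_pos.mpr hlt⟩
  · have hr' : 0 ≤ r - k * Real.log 4 := by linarith
    have hmax : max (sc r (tensorPower ρ k) {tensorPower σ₁ k})
        (sc r (tensorPower ρ k) {tensorPower σ₂ k}) ≤ ((r - k * Real.log 2 : ℝ) : EReal) := by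
      -- The prefix is the whole sequence (l = 1), with damping t = r - k log 4.
      have hb : 1 * (k * Real.log 2) + (r - k * Real.log 4) = r - k * Real.log 2 := by
        rw [log_four]; ring
      rw [← hb]
      exact max_le (sc_singleton_le_of_coin h he₁ zero_le_one le_rfl hr' (by ring))
        (sc_singleton_le_of_coin h.swap he₂ zero_le_one le_rfl hr' (by ring))
    calc ((k * Real.log (√3) : ℝ) : EReal)
        = ((r - k * Real.log (2 / √3) : ℝ) : EReal) - ((r - k * Real.log 2 : ℝ) : EReal) := by
          rw [← EReal.coe_sub, Real.log_div two_ne_zero (by positivity)]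
          congr 1; ring
      _ ≤ _ := EReal.sub_le_sub hlow hmax
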